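/- Let $\omega=(-1+\sqrt3\,i)/2$, $\theta=2\cos(2\pi/7)$, $K=\mathbb{Q}(\omega,\theta)$, $F=\mathbb{Q}(\theta)$, $L=\mathbb{Q}(\omega)$, and let $\sigma\in Gal(K/F)$ be complex conjugation. Let $\mathcal{A}=(K/F,\sigma,-1)=K\oplus\mathbf{j}K$ be the cyclic division algebra with $a\mathbf{j}=\mathbf{j}\sigma(a)$ for $a\in K$ and $\mathbf{j}^2=-1$. The group $Gal(K/L)$ is cyclic and has a generator with $2\cos(2\pi/7)\mapsto 2\cos(4\pi/7)$. Let $\tau$ be any generator of $Gal(K/L)$, and put $\Upsilon(a+\mathbf{j}b)=\tau(a)+\mathbf{j}\tau(b)$ for $a,b\in K$. Then: 1. $A\,\Upsilon(A)\,\Upsilon^2(A)\neq\omega$ for every $A\in\mathcal{A}$. 2. Let $\theta_1=1+\omega+\theta$, $\theta_2=-1-2\omega+\omega\theta^2$, $\theta_3=(-1-2\omega)+(1+\omega)\theta+(1+\omega)\theta^2$. For symbols $s=(s_{ki})_{k=0,1;\,1\le i\le 6}$ put $a_k=\sum_{i=1}^3 s_{ki}\theta_i$, $b_k=\sum_{i=1}^3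 s_{k(i+3)}\theta_i$, $$\mathbf{A}_k=\begin{bmatrix} a_k & -\sigma(b_k)\\ b_k & \sigma(a_k)\end{bmatrix},\qquad \mathbf{S}(s)=\begin{bmatrix}\mathbf{A}_0 & \mathbf{O} & \omega\Upsilon^2(\mathbf{A}_1)\\ \mathbf{A}_1 & \Upsilon(\mathbf{A}_0) & \mathbf{O}\\ \mathbf{O} & \Upsilon(\mathbf{A}_1) & \Upsilon^2(\mathbf{A}_0)\end{bmatrix},$$ where $\Upsilon$ applies $\tau$ to every entry of a matrix. The $6\times2$ code with codewords $\mathbf{S}(s)$ has full diversity over every constellation $M$-HEX $=\{a+\omega b: a,b\in\{-\sqrt M+1,-\sqrt M+3,\dots,\sqrt M-1\}\}$, $M=2^r$ with $r$ even and positive: $\det(\mathbf{S}(s)-\mathbf{S}(s'))\ne0$ for any two distinct symbol vectors $s\neq s'$ with entries in $M$-HEX. 3. The code has a non-vanishing determinant (NVD): with $\mathcal{S}_\infty=\{\mathbf{S}(s): s_{ki}\in\mathbb{Z}[\omega]\}$, $$\inf_{\mathbf{S}\in\mathcal{S}_\infty\setminus\{\mathbf{O}\}}|\det\mathbf{S}|^2>0.$$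 -/

import Mathlib

open scoped IntermediateField Matrix

noncomputable section

/-! ### Cyclic algebras of degree two -/

/-- The cyclic algebra `(K/F, σ, γ)` of degree two, where `σ` is an automorphism of `K` over `F`
with `σ² = 1` and `γ ∈ F`.  The pair `⟨a, b⟩` stands for `a + j b`, so that the algebra is the right
`K`-vector space `K ⊕ jK`, with `a j = j σ(a)` for `a ∈ K`, and `j² = γ`. -/
@[ext]
structure QuadCyclicAlgebra {F K : Type*} [Field F] [Field K] [Algebra F K]
    (σ : K ≃ₐ[F] K) (γ : F) where
  /-- the component `a` of `a + j b` -/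
  fst : K
  /-- the component `b` of `a + j b` -/
  snd : K

namespace QuadCyclicAlgebra

variable {F K : Type*} [Field F] [Field K] [Algebra F K] {σ : K ≃ₐ[F] K} {γ : F}

/-- The embedding of `K`, as `a ↦ a + j 0`. -/
def ofField (σ : K ≃ₐ[F] K) (γ : F) (a : K) : QuadCyclicAlgebra σ γ := ⟨a, 0⟩

instance : Zero (QuadCyclicAlgebra σ γ) := ⟨⟨0, 0⟩⟩
instance : One (QuadCyclicAlgebra σ γ) := ⟨⟨1, 0⟩⟩
instance : Add (QuadCyclicAlgebra σ γ) := ⟨fun A B => ⟨A.fst + B.fst, A.snd + B.snd⟩⟩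
instance : Neg (QuadCyclicAlgebra σ γ) := ⟨fun A => ⟨-A.fst, -A.snd⟩⟩

/-- `(a + j b)(c + j d) = (a c + γ σ(b) d) + j (b c + σ(a) d)`. -/
instance : Mul (QuadCyclicAlgebra σ γ) :=
  ⟨fun A B => ⟨A.fst * B.fst + algebraMap F K γ * σ A.snd * B.snd,
    A.snd * B.fst + σ A.fst * B.snd⟩⟩

@[simp] theorem zero_fst : (0 : QuadCyclicAlgebra σ γ).fst = 0 := rfl
@[simp] theorem zero_snd : (0 : QuadCyclicAlgebra σ γ).snd = 0 := rfl
@[simp] theorem one_fst : (1 : QuadCyclicAlgebra σ γ).fst = 1 := rfl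
@[simp] theorem one_snd : (1 : QuadCyclicAlgebra σ γ).snd = 0 := rfl
@[simp] theorem add_fst (A B : QuadCyclicAlgebra σ γ) : (A + B).fst = A.fst + B.fst := rfl
@[simp] theorem add_snd (A B : QuadCyclicAlgebra σ γ) : (A + B).snd = A.snd + B.snd := rfl
@[simp] theorem neg_fst (A : QuadCyclicAlgebra σ γ) : (-A).fst = -A.fst := rfl
@[simp] theorem neg_snd (A : QuadCyclicAlgebra σ γ) : (-A).snd = -A.snd := rfl
@[simp] theorem mul_fst (A B : QuadCyclicAlgebra σ γ) :
    (A * B).fst = A.fst * B.fst + algebraMap F K γ * σ A.snd * B.snd := rfl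
@[simp] theorem mul_snd (A B : QuadCyclicAlgebra σ γ) :
    (A * B).snd = A.snd * B.fst + σ A.fst * B.snd := rfl

instance [hσ : Fact (∀ x, σ (σ x) = x)] : Ring (QuadCyclicAlgebra σ γ) :=
  Ring.ofMinimalAxioms
    (fun A B C => by ext <;> simp [add_assoc])
    (fun A => by ext <;> simp)
    (fun A => by ext <;> simp)
    (fun A B C => by ext <;> simp [hσ.out] <;> ring)
    (fun A => by ext <;> simp)
    (fun A => by ext <;> simp)
    (fun A B C => by ext <;> simp <;> ring)
    (fun A B C => by ext <;> simp <;> ring)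

/-- The matrix of the left multiplication by `a + j b` on the right `K`-vector space with
basis `1, j`. -/
def toMatrix (A : QuadCyclicAlgebra σ γ) : Matrix (Fin 2) (Fin 2) K :=
  !![A.fst, algebraMap F K γ * σ A.snd; A.snd, σ A.fst]

/-- For an automorphism `τ` of `K`, the map `Υ(a + j b) = τ(a) + j τ(b)`. -/
def upsilon {L : Type*} [Field L] [Algebra L K] (τ : K ≃ₐ[L] K) (A : QuadCyclicAlgebra σ γ) :
    QuadCyclicAlgebra σ γ :=
  ⟨τ A.fst, τ A.snd⟩

end QuadCyclicAlgebra

/-! ### Space-time codes -/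

section Codes

variable {R κ ι : Type*} [Fintype ι] [DecidableEq ι]

/-- The code with encoder `enc` has full diversity over the constellation `𝒜`: the difference of the
codeword matrices of any two distinct vectors of symbols from `𝒜` is invertible. -/
def HasFullDiversity (enc : (κ → R) → Matrix ι ι ℂ) (𝒜 : Set R) : Prop :=
  ∀ s s' : κ → R, (∀ i, s i ∈ 𝒜) → (∀ i, s' i ∈ 𝒜) → s ≠ s' → (enc s - enc s').det ≠ 0

/-- The infinite code `𝒮_∞`: all codeword matrices with symbols in the lattice `Λ`. -/
def infiniteCode (enc : (κ → R) → Matrix ι ι ℂ) (Λ : Set R) : Set (Matrix ι ι ℂ) :=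
  {S | ∃ s : κ → R, (∀ i, s i ∈ Λ) ∧ S = enc s}

/-- Non-vanishing determinant: the infimum of `|det S|²` over the nonzero `S ∈ 𝒮_∞` is positive. -/
def HasNVD (enc : (κ → R) → Matrix ι ι ℂ) (Λ : Set R) : Prop :=
  0 < sInf {d : ℝ | ∃ S ∈ infiniteCode enc Λ, S ≠ 0 ∧ d = ‖S.det‖ ^ 2}

end Codes

/-- `q`-PAM, that is `{-q + 1, -q + 3, …, q - 1}`. -/
def pam (q : ℕ) : Set ℤ := {x | ∃ k : ℕ, k < q ∧ x = 2 * (k : ℤ) - (q : ℤ) + 1}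

/-! ### The fields and the code for the `6 × 2` system -/

namespace Code62

/-- The primitive third root of unity `(-1 + √3 i)/2`. -/
def omegaC : ℂ := (-1 + (Real.sqrt 3 : ℂ) * Complex.I) / 2

/-- The number `2 cos(2π/7)`. -/
def thetaC : ℂ := ((2 * Real.cos (2 * Real.pi / 7) : ℝ) : ℂ)

/-- The field `K = ℚ(ω, θ)`. -/
abbrev K : IntermediateField ℚ ℂ := IntermediateField.adjoin ℚ {omegaC, thetaC}

/-- `ω` as an element of `K`. -/
def omega : K := ⟨omegaC, IntermediateField.subset_adjoin ℚ _ (by simp)⟩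

/-- `θ` as an element of `K`. -/
def theta : K := ⟨thetaC, IntermediateField.subset_adjoin ℚ _ (by simp)⟩

/-- The subfield `F = ℚ(θ)` of `K`. -/
abbrev F : IntermediateField ℚ K := ℚ⟮theta⟯

/-- The subfield `L = ℚ(ω)` of `K`. -/
abbrev L : IntermediateField ℚ K := ℚ⟮omega⟯

/-- Complex conjugation over `ℚ`. -/
def conjQ : ℂ ≃ₐ[ℚ] ℂ := Complex.conjAe.restrictScalars ℚ

theorem conjQ_apply (z : ℂ) : conjQ z = (starRingEnd ℂ) z := rfl

theorem conjQ_omegaC : conjQ omegaC = -1 - omegaC := by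
  simp only [conjQ_apply, omegaC, map_div₀, map_add, map_neg, map_one, map_mul,
    Complex.conj_ofReal, Complex.conj_I, map_ofNat]
  ring

theorem conjQ_thetaC : conjQ thetaC = thetaC := Complex.conj_ofReal _

theorem conjQ_mem (x : ℂ) (hx : x ∈ K) : conjQ x ∈ K := by
  have h : K ≤ K.comap conjQ.toAlgHom := by
    refine IntermediateField.adjoin_le_iff.2 ?_
    rintro y (rfl | rfl)
    · change conjQ omegaC ∈ K
      rw [conjQ_omegaC]
      exact sub_mem (neg_mem (one_mem _)) omega.2
    · change conjQ thetaC ∈ K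
      rw [conjQ_thetaC]
      exact theta.2
  exact h hx

/-- Complex conjugation on `K`, over `ℚ`. -/
def conjK : K →ₐ[ℚ] K := (conjQ.toAlgHom.comp K.val).codRestrict K.toSubalgebra
  (fun x => conjQ_mem x x.2)

theorem coe_conjK (x : K) : ((conjK x : K) : ℂ) = (starRingEnd ℂ) (x : ℂ) := rfl

theorem conjK_conjK (x : K) : conjK (conjK x) = x :=
  Subtype.ext (by rw [coe_conjK, coe_conjK, Complex.conj_conj])

theorem conjK_of_mem (x : K) (hx : x ∈ F) : conjK x = x := by
  have h : F ≤
      { AlgHom.equalizer conjK (AlgHom.id ℚ K) with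
        inv_mem' := fun y (hy : conjK y = y) => by
          change conjK y⁻¹ = y⁻¹
          rw [map_inv₀, hy] } := by
    refine IntermediateField.adjoin_le_iff.2 ?_
    rintro y rfl
    exact Subtype.ext conjQ_thetaC
  exact h hx

/-- The generator `σ` of the Galois group of `K` over `F`: complex conjugation. -/
def sigma : K ≃ₐ[F] K :=
  AlgEquiv.ofAlgHom
    { conjK with commutes' := fun x => conjK_of_mem x x.2 }
    { conjK with commutes' := fun x => conjK_of_mem x x.2 }
    (AlgHom.ext conjK_conjK) (AlgHom.ext conjK_conjK)

theorem coe_sigma (x : K) : ((sigma x : K) : ℂ) = (starRingEnd ℂ) (x : ℂ) := rfl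

instance : Fact (∀ x, sigma (sigma x) = x) := ⟨conjK_conjK⟩

/-- The algebra `𝒜 = (ℚ(ω, θ)/ℚ(θ), σ, -1)`. -/
abbrev CDA : Type := QuadCyclicAlgebra sigma (-1 : F)

theorem norm_ne_zero (A : CDA) (hA : A ≠ 0) :
    A.fst * sigma A.fst + A.snd * sigma A.snd ≠ 0 := by
  intro h
  have h1 := congrArg (fun z : K => ((z : ℂ)).re) h
  have h2 : Complex.normSq (A.fst : ℂ) + Complex.normSq (A.snd : ℂ) = 0 := by
    have h3 : ((A.fst : ℂ) * (starRingEnd ℂ) (A.fst : ℂ)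
        + (A.snd : ℂ) * (starRingEnd ℂ) (A.snd : ℂ)).re = 0 := h1
    rw [Complex.mul_conj, Complex.mul_conj, ← Complex.ofReal_add, Complex.ofReal_re] at h3
    exact h3
  have ha := Complex.normSq_nonneg (A.fst : ℂ)
  have hb := Complex.normSq_nonneg (A.snd : ℂ)
  have ha' : (A.fst : ℂ) = 0 := Complex.normSq_eq_zero.1 (by linarith)
  have hb' : (A.snd : ℂ) = 0 := Complex.normSq_eq_zero.1 (by linarith)
  exact hA (QuadCyclicAlgebra.ext (Subtype.ext ha') (Subtype.ext hb'))

/-- `𝒜` is a division algebra: the inverse of `a + j b` is `(σ(a) - j b) / (a σ(a) + b σ(b))`. -/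
instance : DivisionRing CDA where
  inv A := ⟨sigma A.fst / (A.fst * sigma A.fst + A.snd * sigma A.snd),
    -A.snd / (A.fst * sigma A.fst + A.snd * sigma A.snd)⟩
  exists_pair_ne := ⟨0, 1, fun h => zero_ne_one (congrArg QuadCyclicAlgebra.fst h)⟩
  mul_inv_cancel A hA := by
    have hN := norm_ne_zero A hA
    ext1
    · change A.fst * (sigma A.fst / _) + algebraMap F K (-1) * sigma A.snd * (-A.snd / _) = 1
      rw [map_neg, map_one]
      field_simp
    · change A.snd * (sigma A.fst / _) + sigma A.fst * (-A.snd / _) = 0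
      ring
  inv_zero := by
    ext1
    · change sigma 0 / _ = (0 : K)
      rw [map_zero, zero_div]
    · change -(0 : K) / _ = (0 : K)
      rw [neg_zero, zero_div]
  nnqsmul := _
  qsmul := _

/-- `ω` as an element of `𝒜`. -/
def omegaA : CDA := QuadCyclicAlgebra.ofField sigma (-1 : F) omega

/-- The lattice `ℤ[ω]`. -/
def eisenstein : Set K := {x | ∃ a b : ℤ, x = (a : K) + omega * (b : K)}

/-- The constellation `M`-HEX. -/
def hex (M : ℕ) : Set K :=
  {x | ∃ a ∈ pam (Nat.sqrt M), ∃ b ∈ pam (Nat.sqrt M), x = (a : K) + omega * (b : K)}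

/-- The elements `θ₁, θ₂, θ₃`. -/
def basis : Fin 3 → K :=
  ![1 + omega + theta,
    -1 - 2 * omega + omega * theta ^ 2,
    (-1 - 2 * omega) + (1 + omega) * theta + (1 + omega) * theta ^ 2]

/-- The element `A_k = ∑ s_{k,i} θ_i + j ∑ s_{k,i+3} θ_i` of `𝒜`. -/
def symbolElement (s : Fin 2 × Fin 6 → K) (k : Fin 2) : CDA :=
  ⟨∑ i : Fin 3, s (k, Fin.castAdd 3 i) * basis i, ∑ i : Fin 3, s (k, Fin.natAdd 3 i) * basis i⟩

/-- The `6 × 6` codeword matrix, made of `2 × 2` blocks, for the symbols `s`; here `Υ` is the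
application of `τ` to every entry of a matrix. -/
def encode (τ : K ≃ₐ[L] K) (s : Fin 2 × Fin 6 → K) : Matrix (Fin 3 × Fin 2) (Fin 3 × Fin 2) ℂ :=
  let A₀ : Matrix (Fin 2) (Fin 2) K := (symbolElement s 0).toMatrix
  let A₁ : Matrix (Fin 2) (Fin 2) K := (symbolElement s 1).toMatrix
  let Υ : Matrix (Fin 2) (Fin 2) K → Matrix (Fin 2) (Fin 2) K := fun X => X.map τ
  let blocks : Matrix (Fin 3) (Fin 3) (Matrix (Fin 2) (Fin 2) K) :=
    !![A₀, 0, omega • Υ (Υ A₁);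
       A₁, Υ A₀, 0;
       0, Υ A₁, Υ (Υ A₀)]
  (Matrix.comp (Fin 3) (Fin 3) (Fin 2) (Fin 2) K blocks).map (fun x : K => (x : ℂ))

end Code62

end

/-!
The three statements rest on one arithmetic fact: `ω` is not a norm from `K = ℚ(ω, θ)` to
`L = ℚ(ω)`.

*`ω` is not a norm.* The element `η = θ - 2` has minimal polynomial `X³ + 7X² + 14X + 7`, which is
Eisenstein at `7`, and `normForm x y z` is the norm of `x + yη + zη²`. The field `L` embeds in
`ℚ₇`, and the image of `ω` reduces modulo `7` to an element of order three of `𝔽₇ˣ`, which is not a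
cube. Since `normForm x y z ≡ x³` modulo `7`, a descent on powers of `7` shows that
`normForm x y z = ω d³` has only the zero solution (`eq_zero_of_normForm_eq_omegaL`). The same fact
gives the irreducibility of the cubic of `θ` over `L`, hence the existence of `τ`, and the
independence of `1, θ, θ²` over `L`.

*Twisted norms in `𝒜`.* If `A Υ(A) Υ²(A) = ω`, then applying `Υ` shows that `A` commutes with `ω`,
so that `A` lies in `K` and `ω` is its norm (`twisted_norm_ne_omega`).

*Invertibility of codewords.* A column of length two over `K` is an element of `𝒜`, on which matrices
of elements of `𝒜` act by left multiplication and the scalar `ω` by right multiplication. A kernel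
vector of a codeword becomes a solution `x, y, z` of a cyclic linear system over `𝒜`; if it is not
zero, then `-x⁻¹ A₁⁻¹ Υ(A₀) Υ(x)` has twisted norm `ω` (`eq_zero_of_cyclic_system`). Together with
the independence of `θ₁, θ₂, θ₃` over `L` this gives full diversity.

*Non-vanishing determinant.* A twisted cyclic shift of the blocks conjugates a codeword matrix into
its image under `τ`, so its determinant is fixed by `τ` and lies in `L` (`map_det_codeMatrix`). For
symbols in `ℤ[ω]` it is an algebraic integer as well, so `|det|²` is a rational integer; being
nonzero, it is at least `1`.
-/

noncomputable section

namespace Code62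

/-! ### A cubic form over the 7-adic numbers -/

section Fields

open Polynomial

instance fact_prime_seven : Fact (Nat.Prime 7) := ⟨by norm_num⟩

/-- The norm of `x + y η + z η²`, where `η³ + 7 η² + 14 η + 7 = 0`. -/
def normForm {R : Type*} [CommRing R] (x y z : R) : R :=
  x ^ 3 - 7 * x ^ 2 * y + 21 * x ^ 2 * z + 14 * x * y ^ 2 - 77 * x * y * z + 98 * x * z ^ 2
    - 7 * y ^ 3 + 49 * y ^ 2 * z - 98 * y * z ^ 2 + 49 * z ^ 3

theorem seven_dvd_iff_toZMod (x : ℤ_[7]) : 7 ∣ x ↔ PadicInt.toZMod x = 0 := by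
  rw [← RingHom.mem_ker, PadicInt.ker_toZMod, PadicInt.maximalIdeal_eq_span_p,
    Ideal.mem_span_singleton]
  norm_num

/-- A primitive third root of unity is not a cube modulo `7`. -/
theorem seven_dvd_of_cube_eq {w x d : ℤ_[7]} (hw : w ^ 2 + w + 1 = 0)
    (h : 7 ∣ x ^ 3 - w * d ^ 3) : 7 ∣ x ∧ 7 ∣ d := by
  rw [seven_dvd_iff_toZMod] at *
  rw [seven_dvd_iff_toZMod]
  have hw' := congrArg (PadicInt.toZMod (p := 7)) hw
  simp only [map_sub, map_mul, map_pow, map_add, map_one, map_zero] at h hw'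
  generalize PadicInt.toZMod w = w at *
  generalize PadicInt.toZMod x = x at *
  generalize PadicInt.toZMod d = d at *
  revert w x d
  decide

/-- The descent step. The coefficients of `x³`, `y³` and `z³` have `7`-adic valuations `0`, `1` and
`2`; modulo `7`, `7²` and `7³` in turn, every other term vanishes once the variables already treated
are divisible by `7`. -/
theorem seven_dvd_of_normForm_eq {w x y z d : ℤ_[7]} (hw : w ^ 2 + w + 1 = 0)
    (h : normForm x y z = w * d ^ 3) : 7 ∣ x ∧ 7 ∣ y ∧ 7 ∣ z ∧ 7 ∣ d := by
  have hp : Prime (7 : ℤ_[7]) := by exact_mod_cast PadicInt.prime_p (p := 7)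
  have h7 : (7 : ℤ_[7]) ≠ 0 := hp.ne_zero
  unfold normForm at h
  obtain ⟨⟨x, rfl⟩, ⟨d, rfl⟩⟩ : 7 ∣ x ∧ 7 ∣ d := by
    refine seven_dvd_of_cube_eq hw ⟨x ^ 2 * y - 3 * x ^ 2 * z - 2 * x * y ^ 2 + 11 * x * y * z
      - 14 * x * z ^ 2 + y ^ 3 - 7 * y ^ 2 * z + 14 * y * z ^ 2 - 7 * z ^ 3, ?_⟩
    linear_combination h
  obtain ⟨y, rfl⟩ : 7 ∣ y := by
    refine hp.dvd_of_dvd_pow (n := 3) ⟨7 * x ^ 3 - 7 * x ^ 2 * y + 21 * x ^ 2 * z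
      + 2 * x * y ^ 2 - 11 * x * y * z + 14 * x * z ^ 2 + y ^ 2 * z - 2 * y * z ^ 2 + z ^ 3
      - 7 * w * d ^ 3, ?_⟩
    refine mul_left_cancel₀ h7 ?_
    linear_combination -h
  obtain ⟨z, rfl⟩ : 7 ∣ z := by
    refine hp.dvd_of_dvd_pow (n := 3) ⟨- (x ^ 3 - 7 * x ^ 2 * y + 3 * x ^ 2 * z
      + 14 * x * y ^ 2 - 11 * x * y * z + 2 * x * z ^ 2
      - 7 * y ^ 3 + 7 * y ^ 2 * z - 2 * y * z ^ 2 - w * d ^ 3), ?_⟩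
    refine mul_left_cancel₀ (pow_ne_zero 2 h7) ?_
    linear_combination h
  exact ⟨⟨x, rfl⟩, ⟨y, rfl⟩, ⟨z, rfl⟩, ⟨d, rfl⟩⟩

theorem seven_pow_dvd_of_normForm_eq {w : ℤ_[7]} (hw : w ^ 2 + w + 1 = 0) (n : ℕ) :
    ∀ {x y z d : ℤ_[7]}, normForm x y z = w * d ^ 3 →
      7 ^ n ∣ x ∧ 7 ^ n ∣ y ∧ 7 ^ n ∣ z ∧ 7 ^ n ∣ d := by
  induction n with
  | zero => simp
  | succ n ih =>
    intro x y z d h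
    obtain ⟨⟨x, rfl⟩, ⟨y, rfl⟩, ⟨z, rfl⟩, ⟨d, rfl⟩⟩ := seven_dvd_of_normForm_eq hw h
    have h7 : (7 : ℤ_[7]) ≠ 0 := by norm_num
    have h' : normForm x y z = w * d ^ 3 := by
      refine mul_left_cancel₀ (pow_ne_zero 3 h7) ?_
      unfold normForm at *
      linear_combination h
    obtain ⟨hx, hy, hz, hd⟩ := ih h'
    rw [pow_succ']
    exact ⟨mul_dvd_mul_left 7 hx, mul_dvd_mul_left 7 hy, mul_dvd_mul_left 7 hz,
      mul_dvd_mul_left 7 hd⟩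

theorem eq_zero_of_forall_seven_pow_dvd {x : ℤ_[7]} (h : ∀ n : ℕ, 7 ^ n ∣ x) : x = 0 := by
  by_contra hx
  have hp : Prime (7 : ℤ_[7]) := by exact_mod_cast PadicInt.prime_p (p := 7)
  obtain ⟨n, hn⟩ := FiniteMultiplicity.of_prime_left hp hx
  exact hn (h _)

theorem exists_root_padic : ∃ w : ℤ_[7], w ^ 2 + w + 1 = 0 := by
  have h7 : ‖(7 : ℤ_[7])‖ < 1 := by
    exact_mod_cast (PadicInt.norm_int_lt_one_iff_dvd (7 : ℤ)).2 dvd_rfl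
  have h5 : ‖(5 : ℤ_[7])‖ = 1 := by
    refine le_antisymm (PadicInt.norm_le_one _) (not_lt.1 fun h => ?_)
    have := (PadicInt.norm_int_lt_one_iff_dvd (p := 7) (5 : ℤ)).1 (by exact_mod_cast h)
    norm_num at this
  obtain ⟨w, hw, -⟩ := hensels_lemma (p := 7) (F := (X ^ 2 + X + 1 : ℤ[X])) (a := 2) (by
    -- `2` is a simple root modulo `7`: the values of the polynomial and its derivative are `7`, `5`.
    have e1 : aeval (2 : ℤ_[7]) (X ^ 2 + X + 1 : ℤ[X]) = 7 := by
      simp only [map_add, map_pow, aeval_X, map_one]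
      norm_num
    have e2 : aeval (2 : ℤ_[7]) (derivative (X ^ 2 + X + 1 : ℤ[X])) = 5 := by
      simp only [derivative_X_pow, derivative_X, derivative_one, map_add, map_mul,
        map_pow, aeval_X, map_one, map_zero, Nat.cast_ofNat, map_ofNat]
      norm_num
    rwa [e1, e2, h5, one_pow])
  exact ⟨w, by simpa using hw⟩

theorem eq_zero_of_normForm_eq {w x y z d : ℚ_[7]} (hw : w ^ 2 + w + 1 = 0)
    (h : normForm x y z = w * d ^ 3) : x = 0 ∧ y = 0 ∧ z = 0 ∧ d = 0 := by
  classical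
  have hw1 : ‖w‖ ≤ 1 := by
    have h3 : w ^ 3 = 1 := by linear_combination (w - 1) * hw
    have := congrArg norm h3
    rw [norm_pow, norm_one] at this
    exact ((pow_eq_one_iff_of_nonneg (norm_nonneg w) (by norm_num)).1 this).le
  have hinj := IsFractionRing.injective ℤ_[7] ℚ_[7]
  obtain ⟨w, rfl⟩ : ∃ v : ℤ_[7], algebraMap ℤ_[7] ℚ_[7] v = w := ⟨⟨w, hw1⟩, rfl⟩
  have hw' : w ^ 2 + w + 1 = 0 := hinj (by simpa using hw)
  obtain ⟨⟨b, hb⟩, hint⟩ := IsLocalization.exist_integer_multiples_of_finset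
    (nonZeroDivisors ℤ_[7]) ({x, y, z, d} : Finset ℚ_[7])
  have hb0 : algebraMap ℤ_[7] ℚ_[7] b ≠ 0 :=
    (map_ne_zero_iff _ hinj).2 (nonZeroDivisors.ne_zero hb)
  obtain ⟨x', hx⟩ := hint x (by simp)
  obtain ⟨y', hy⟩ := hint y (by simp)
  obtain ⟨z', hz⟩ := hint z (by simp)
  obtain ⟨d', hd⟩ := hint d (by simp)
  rw [Algebra.smul_def] at hx hy hz hd
  have h' : normForm x' y' z' = w * d' ^ 3 := by
    apply hinj
    unfold normForm at *
    simp only [map_add, map_sub, map_mul, map_pow, map_ofNat]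
    rw [hx, hy, hz, hd]
    linear_combination (algebraMap ℤ_[7] ℚ_[7] b) ^ 3 * h
  have hdvd := fun n => seven_pow_dvd_of_normForm_eq hw' n h'
  rw [eq_zero_of_forall_seven_pow_dvd fun n => (hdvd n).1, map_zero] at hx
  rw [eq_zero_of_forall_seven_pow_dvd fun n => (hdvd n).2.1, map_zero] at hy
  rw [eq_zero_of_forall_seven_pow_dvd fun n => (hdvd n).2.2.1, map_zero] at hz
  rw [eq_zero_of_forall_seven_pow_dvd fun n => (hdvd n).2.2.2, map_zero] at hd
  exact ⟨(mul_eq_zero.1 hx.symm).resolve_left hb0, (mul_eq_zero.1 hy.symm).resolve_left hb0,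
    (mul_eq_zero.1 hz.symm).resolve_left hb0, (mul_eq_zero.1 hd.symm).resolve_left hb0⟩

/-! ### The generators of `K` -/

theorem omega_sq_add : omega ^ 2 + omega + 1 = 0 := by
  apply Subtype.coe_injective
  change omegaC ^ 2 + omegaC + 1 = 0
  have h3 : (Real.sqrt 3 : ℂ) ^ 2 = 3 := by
    exact_mod_cast congrArg Complex.ofReal (Real.sq_sqrt (show (0 : ℝ) ≤ 3 by norm_num))
  unfold omegaC
  linear_combination (1 / 4) * Complex.I ^ 2 * h3 + (3 / 4) * Complex.I_sq

/-- With `u = exp(ix)`, a nontrivial seventh root of unity, `2 cos x = u + u⁶`. -/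
theorem two_mul_cos_cubic {x : ℂ} (h : Complex.exp (x * Complex.I) ^ 7 = 1)
    (h1 : Complex.exp (x * Complex.I) ≠ 1) :
    (2 * Complex.cos x) ^ 3 + (2 * Complex.cos x) ^ 2 - 2 * (2 * Complex.cos x) - 1 = 0 := by
  have h2 : 2 * Complex.cos x = Complex.exp (x * Complex.I) + Complex.exp (x * Complex.I) ^ 6 := by
    have : Complex.exp (-x * Complex.I) = Complex.exp (x * Complex.I) ^ 6 := by
      have h0 := Complex.exp_ne_zero (x * Complex.I)
      rw [neg_mul, Complex.exp_neg]
      field_simp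
      rw [← h]
    rw [Complex.cos, this]
    ring
  rw [h2]
  generalize Complex.exp (x * Complex.I) = u at h h1
  have h3 : 1 + u + u ^ 2 + u ^ 3 + u ^ 4 + u ^ 5 + u ^ 6 = 0 := by
    refine (mul_eq_zero.1 (?_ : (u - 1) * _ = 0)).resolve_left (sub_ne_zero.2 h1)
    linear_combination h
  linear_combination h3 + (u ^ 5 + 2 + 3 * u + 3 * u ^ 6 + u ^ 4 * (u ^ 7 + 1)) * h

theorem theta_cubic : theta ^ 3 + theta ^ 2 - 2 * theta - 1 = 0 := by
  apply Subtype.coe_injective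
  change thetaC ^ 3 + thetaC ^ 2 - 2 * thetaC - 1 = 0
  have h := Complex.isPrimitiveRoot_exp 7 (by norm_num)
  have he : ((2 * Real.pi / 7 : ℝ) : ℂ) * Complex.I = 2 * Real.pi * Complex.I / (7 : ℕ) := by
    push_cast; ring
  have := two_mul_cos_cubic (x := ((2 * Real.pi / 7 : ℝ) : ℂ)) (by rw [he]; exact h.pow_eq_one)
    (by rw [he]; exact h.ne_one (by norm_num))
  rw [thetaC]
  push_cast at *
  exact this

theorem isPrimitiveRoot_omega : IsPrimitiveRoot omega 3 := by
  rw [← isRoot_cyclotomic_iff, cyclotomic_three, IsRoot.def]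
  simpa using omega_sq_add

theorem nonempty_algHom_padic : Nonempty (L →ₐ[ℚ] ℚ_[7]) := by
  obtain ⟨w, hw⟩ := exists_root_padic
  have hint : IsIntegral ℚ omega := isPrimitiveRoot_omega.isIntegral (by norm_num) |>.tower_top
  refine ⟨(IntermediateField.algHomAdjoinIntegralEquiv ℚ hint).symm
    ⟨algebraMap ℤ_[7] ℚ_[7] w, ?_⟩⟩
  rw [← cyclotomic_eq_minpoly_rat isPrimitiveRoot_omega (by norm_num), cyclotomic_three,
    mem_aroots']
  refine ⟨?_, ?_⟩
  · rw [← cyclotomic_three, map_cyclotomic]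
    exact cyclotomic_ne_zero _ _
  · simp only [map_add, map_pow, aeval_X, map_one]
    simpa using congrArg (algebraMap ℤ_[7] ℚ_[7]) hw

/-- `ω` as an element of `L`. -/
def omegaL : L := ⟨omega, IntermediateField.mem_adjoin_simple_self ℚ omega⟩

theorem eq_zero_of_normForm_eq_omegaL {x y z d : L} (h : normForm x y z = omegaL * d ^ 3) :
    x = 0 ∧ y = 0 ∧ z = 0 ∧ d = 0 := by
  obtain ⟨φ⟩ := nonempty_algHom_padic
  have hw : omegaL ^ 2 + omegaL + 1 = 0 := Subtype.coe_injective omega_sq_add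
  have := eq_zero_of_normForm_eq (w := φ omegaL) (x := φ x) (y := φ y) (z := φ z) (d := φ d)
    (by simpa using congrArg φ hw) (by simpa [normForm, map_ofNat] using congrArg φ h)
  simpa using this

/-- The minimal polynomial of `θ`, over `L`. -/
def thetaPoly : L[X] := X ^ 3 + X ^ 2 - 2 * X - 1

theorem thetaPoly_natDegree : thetaPoly.natDegree = 3 := by
  unfold thetaPoly
  compute_degree!

theorem thetaPoly_monic : thetaPoly.Monic := by
  unfold thetaPoly
  monicity!

theorem thetaPoly_aeval {x : K} : aeval x thetaPoly = x ^ 3 + x ^ 2 - 2 * x - 1 := by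
  simp [thetaPoly, map_ofNat]

/-- A root `r` in `L` would make `θ - r = (2 - r) + η` an element of norm zero. -/
theorem thetaPoly_irreducible : Irreducible thetaPoly := by
  rw [thetaPoly_monic.irreducible_iff_roots_eq_zero_of_degree_le_three
    (by rw [thetaPoly_natDegree]; norm_num) (by rw [thetaPoly_natDegree])]
  refine Multiset.eq_zero_of_forall_notMem fun r hr => ?_
  have hr : r ^ 3 + r ^ 2 - 2 * r - 1 = 0 := by
    simpa [thetaPoly] using (mem_roots'.1 hr).2
  have := eq_zero_of_normForm_eq_omegaL (x := 2 - r) (y := 1) (z := 0) (d := 0) (by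
    unfold normForm
    linear_combination -hr)
  exact one_ne_zero this.2.1

theorem isIntegral_theta : IsIntegral L theta :=
  ⟨thetaPoly, thetaPoly_monic, by
    rw [← aeval_def, thetaPoly_aeval, theta_cubic]⟩

theorem minpoly_theta : minpoly L theta = thetaPoly :=
  (minpoly.eq_of_irreducible_of_monic thetaPoly_irreducible
    (by rw [thetaPoly_aeval, theta_cubic]) thetaPoly_monic).symm

theorem ringHom_ext_of_omega_theta {f g : K →+* K} (h1 : f omega = g omega)
    (h2 : f theta = g theta) : f = g := by
  refine RingHom.ext fun ⟨x, hx⟩ => ?_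
  induction hx using IntermediateField.adjoin_induction with
  | mem x hx =>
    rcases hx with rfl | rfl
    · exact h1
    · exact h2
  | algebraMap q => exact (map_ratCast f q).trans (map_ratCast g q).symm
  | add x y hx hy h1 h2 =>
    exact (map_add f ⟨x, hx⟩ ⟨y, hy⟩).trans
      ((congrArg₂ _ h1 h2).trans (map_add g ⟨x, hx⟩ ⟨y, hy⟩).symm)
  | inv x hx h1 =>
    exact (map_inv₀ f ⟨x, hx⟩).trans ((congrArg _ h1).trans (map_inv₀ g ⟨x, hx⟩).symm)
  | mul x y hx hy h1 h2 =>
    exact (map_mul f ⟨x, hx⟩ ⟨y, hy⟩).trans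
      ((congrArg₂ _ h1 h2).trans (map_mul g ⟨x, hx⟩ ⟨y, hy⟩).symm)

theorem adjoin_theta : IntermediateField.adjoin L {theta} = ⊤ := by
  refine eq_top_iff.2 fun ⟨x, hx⟩ h => ?_
  clear h
  induction hx using IntermediateField.adjoin_induction with
  | mem x hx =>
    rcases hx with rfl | rfl
    · exact (IntermediateField.adjoin L {theta}).algebraMap_mem omegaL
    · exact IntermediateField.mem_adjoin_simple_self L theta
  | algebraMap q =>
    exact SubfieldClass.ratCast_mem (IntermediateField.adjoin L {theta}) q
  | add x y hx hy h1 h2 => exact add_mem h1 h2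
  | inv x hx h1 => exact inv_mem h1
  | mul x y hx hy h1 h2 => exact mul_mem h1 h2

theorem algebra_adjoin_theta : Algebra.adjoin L {theta} = ⊤ :=
  Algebra.adjoin_eq_top_of_intermediateField
    (by rintro x rfl; exact isIntegral_theta.isAlgebraic) adjoin_theta

/-- The remainder of a polynomial in `θ` modulo the cubic of `θ` has degree less than three. -/
theorem exists_coords (x : K) : ∃ a b c : L, x = a + b * theta + c * theta ^ 2 := by
  have hx : x ∈ Algebra.adjoin L {theta} := by rw [algebra_adjoin_theta]; trivial
  rw [Algebra.adjoin_singleton_eq_range_aeval] at hx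
  obtain ⟨p, rfl⟩ := hx
  have hdeg : (p %ₘ thetaPoly).natDegree < 3 := by
    rw [← thetaPoly_natDegree]
    refine natDegree_modByMonic_lt _ thetaPoly_monic fun h => ?_
    have := thetaPoly_natDegree
    simp [h] at this
  refine ⟨(p %ₘ thetaPoly).coeff 0, (p %ₘ thetaPoly).coeff 1, (p %ₘ thetaPoly).coeff 2, ?_⟩
  change aeval theta p = _
  rw [← aeval_modByMonic_eq_self_of_root (q := thetaPoly)
    (by rw [thetaPoly_aeval, theta_cubic]), aeval_eq_sum_range' hdeg]
  simp [Finset.sum_range_succ, Algebra.smul_def]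

/-! ### The automorphisms of `K` over `L` -/

theorem algEquiv_ext_of_theta {f g : K ≃ₐ[L] K} (h : f theta = g theta) : f = g := by
  have : (f : K →ₐ[L] K) = g :=
    AlgHom.ext_of_adjoin_eq_top algebra_adjoin_theta (by rintro x rfl; exact h)
  exact AlgEquiv.ext fun x => DFunLike.congr_fun this x

/-- The conjugates of `θ` are `θ`, `θ² - 2` and `1 - θ - θ²`. -/
theorem root_cases {x : K} (hx : x ^ 3 + x ^ 2 - 2 * x - 1 = 0) :
    x = theta ∨ x = theta ^ 2 - 2 ∨ x = 1 - theta - theta ^ 2 := by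
  have h : (x - theta) * ((x - (theta ^ 2 - 2)) * (x - (1 - theta - theta ^ 2))) = 0 := by
    have := theta_cubic
    grind
  simpa [sub_eq_zero] using h

theorem theta_sq_sub_two_ne : theta ^ 2 - 2 ≠ theta := by
  intro h
  have := theta_cubic
  have h1 : (7 : K) = 0 := by grind
  norm_num at h1

theorem exists_algEquiv_theta : ∃ τ : K ≃ₐ[L] K, τ theta = theta ^ 2 - 2 := by
  let pb := PowerBasis.ofAdjoinEqTop isIntegral_theta algebra_adjoin_theta
  have : FiniteDimensional L K := pb.finite
  have hgen : pb.gen = theta := PowerBasis.ofAdjoinEqTop_gen _ _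
  have h : aeval (theta ^ 2 - 2) (minpoly L pb.gen) = 0 := by
    rw [hgen, minpoly_theta, thetaPoly_aeval]
    have := theta_cubic
    grind
  refine ⟨AlgEquiv.ofBijective (pb.lift _ h) (AlgHom.bijective _), ?_⟩
  have := pb.lift_gen _ h
  rwa [hgen] at this

theorem algEquiv_cubic (τ : K ≃ₐ[L] K) : (τ theta) ^ 3 + (τ theta) ^ 2 - 2 * τ theta - 1 = 0 := by
  simpa [map_ofNat] using congrArg τ theta_cubic

theorem zpowers_eq_top {τ : K ≃ₐ[L] K} (h : τ theta = theta ^ 2 - 2) :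
    Subgroup.zpowers τ = ⊤ := by
  refine eq_top_iff.2 fun g _ => ?_
  rcases root_cases (algEquiv_cubic g) with hg | hg | hg
  · rw [algEquiv_ext_of_theta (f := g) (g := 1) (by simpa using hg)]
    exact one_mem _
  · rw [algEquiv_ext_of_theta (f := g) (g := τ) (by rw [hg, h])]
    exact Subgroup.mem_zpowers τ
  · rw [algEquiv_ext_of_theta (f := g) (g := τ * τ) ?_]
    · exact mul_mem (Subgroup.mem_zpowers τ) (Subgroup.mem_zpowers τ)
    · rw [hg, AlgEquiv.mul_apply, h, map_sub, map_pow, h, map_ofNat]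
      have := theta_cubic
      grind

theorem theta_sq_sub_two_eq :
    ((theta ^ 2 - 2 : K) : ℂ) = ((2 * Real.cos (4 * Real.pi / 7) : ℝ) : ℂ) := by
  change thetaC ^ 2 - 2 = _
  rw [show 4 * Real.pi / 7 = 2 * (2 * Real.pi / 7) by ring, Real.cos_two_mul, thetaC]
  push_cast
  ring

/-- A generator is not the identity, and so does not fix `θ`. -/
theorem generator_cases {τ : K ≃ₐ[L] K} (hτ : Subgroup.zpowers τ = ⊤) :
    (τ theta = theta ^ 2 - 2 ∧ τ (τ theta) = 1 - theta - theta ^ 2) ∨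
      (τ theta = 1 - theta - theta ^ 2 ∧ τ (τ theta) = theta ^ 2 - 2) := by
  have hf := theta_cubic
  rcases root_cases (algEquiv_cubic τ) with h | h | h
  · have h1 : τ = 1 := algEquiv_ext_of_theta (by simpa using h)
    obtain ⟨g, hg⟩ := exists_algEquiv_theta
    have : g ∈ Subgroup.zpowers τ := by rw [hτ]; trivial
    rw [h1, Subgroup.zpowers_one_eq_bot, Subgroup.mem_bot] at this
    rw [this] at hg
    exact absurd hg.symm theta_sq_sub_two_ne
  · refine .inl ⟨h, ?_⟩
    rw [h, map_sub, map_pow, h, map_ofNat]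
    grind
  · refine .inr ⟨h, ?_⟩
    rw [h, map_sub, map_sub, map_pow, h, map_one]
    grind

theorem generator_cube {τ : K ≃ₐ[L] K} (hτ : Subgroup.zpowers τ = ⊤) (x : K) :
    τ (τ (τ x)) = x := by
  have hf := theta_cubic
  have h : τ * τ * τ = 1 := by
    refine algEquiv_ext_of_theta ?_
    simp only [AlgEquiv.mul_apply, AlgEquiv.one_apply]
    rcases generator_cases hτ with ⟨h1, h2⟩ | ⟨h1, h2⟩
    · rw [h2, map_sub, map_sub, map_pow, h1, map_one]
      grind
    · rw [h2, map_sub, map_pow, h1, map_ofNat]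
      grind
  exact DFunLike.congr_fun h x

theorem algEquiv_omega (τ : K ≃ₐ[L] K) : τ omega = omega := τ.commutes omegaL

theorem algEquiv_coe (τ : K ≃ₐ[L] K) (x : L) : τ (x : K) = x := τ.commutes x

theorem sigma_theta : sigma theta = theta := Subtype.coe_injective conjQ_thetaC

theorem sigma_omega : sigma omega = -1 - omega := Subtype.coe_injective conjQ_omegaC

theorem sigma_comm (τ : K ≃ₐ[L] K) (hτ : Subgroup.zpowers τ = ⊤) (x : K) :
    sigma (τ x) = τ (sigma x) := by
  have h : (sigma : K →+* K).comp (τ : K →+* K) = (τ : K →+* K).comp (sigma : K →+* K) := by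
    refine ringHom_ext_of_omega_theta ?_ ?_
    · change sigma (τ omega) = τ (sigma omega)
      rw [algEquiv_omega, sigma_omega, map_sub, map_neg, map_one, algEquiv_omega]
    · change sigma (τ theta) = τ (sigma theta)
      rw [sigma_theta]
      rcases generator_cases hτ with ⟨h1, -⟩ | ⟨h1, -⟩
      · rw [h1, map_sub, map_pow, sigma_theta, map_ofNat]
      · rw [h1, map_sub, map_sub, map_pow, sigma_theta, map_one]
  exact DFunLike.congr_fun h x

/-- The substitution `t = η + 2` turns `a + b t + c t²` into
`(a + 2 b + 4 c) + (b + 4 c) η + c η²`; the other two factors are the conjugates. -/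
theorem mul_conjugates_eq_normForm {R : Type*} [CommRing R] {t : R}
    (h : t ^ 3 + t ^ 2 - 2 * t - 1 = 0) (a b c : R) :
    (a + b * t + c * t ^ 2) * (a + b * (t ^ 2 - 2) + c * (t ^ 2 - 2) ^ 2) *
      (a + b * (1 - t - t ^ 2) + c * (1 - t - t ^ 2) ^ 2) =
    normForm (a + 2 * b + 4 * c) (b + 4 * c) c := by
  have h1 : (t ^ 2 - 2) ^ 2 = 3 - t - t ^ 2 := by linear_combination (t - 1) * h
  have h2 : (1 - t - t ^ 2) ^ 2 = t + 2 := by linear_combination (t + 1) * h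
  rw [h1, h2, normForm]
  grind

theorem map_normForm {R S : Type*} [CommRing R] [CommRing S] (f : R →+* S) (a b c : R) :
    f (normForm a b c) = normForm (f a) (f b) (f c) := by
  simp only [normForm, map_add, map_sub, map_mul, map_pow, map_ofNat]

theorem coe_normForm (a b c : L) : ((normForm a b c : L) : K) = normForm (a : K) b c :=
  map_normForm (algebraMap L K) a b c

/-- The norm of `a + b θ + c θ²` from `K` to `L`, after the substitution `θ = η + 2`. -/
theorem mul_conjugates_eq_coe_normForm {τ : K ≃ₐ[L] K} (hτ : Subgroup.zpowers τ = ⊤) (a b c : L)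
    {x : K} (hx : x = a + b * theta + c * theta ^ 2) :
    x * τ x * τ (τ x) = (normForm (a + 2 * b + 4 * c) (b + 4 * c) c : L) := by
  have h2' : ((2 : L) : K) = 2 := map_ofNat (algebraMap L K) 2
  have h4' : ((4 : L) : K) = 4 := map_ofNat (algebraMap L K) 4
  rw [hx, coe_normForm]
  push_cast
  rw [h2', h4', ← mul_conjugates_eq_normForm theta_cubic]
  simp only [map_add, map_mul, map_pow, algEquiv_coe]
  rcases generator_cases hτ with ⟨h1, h2⟩ | ⟨h1, h2⟩
  · rw [h2, h1]
  · rw [h2, h1]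
    ring

theorem norm_ne_omega {τ : K ≃ₐ[L] K} (hτ : Subgroup.zpowers τ = ⊤) (x : K) :
    x * τ x * τ (τ x) ≠ omega := by
  intro h
  obtain ⟨a, b, c, hx⟩ := exists_coords x
  have h' := (mul_conjugates_eq_coe_normForm hτ a b c hx).symm.trans h
  have := eq_zero_of_normForm_eq_omegaL (d := 1)
    (Subtype.coe_injective (h'.trans (congrArg Subtype.val
      (show omegaL = omegaL * 1 ^ 3 by rw [one_pow, mul_one]))))
  exact one_ne_zero this.2.2.2

/-- A fixed element is one third of its trace, and `θ`, `θ²` have traces `-1` and `5`. -/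
theorem mem_of_algEquiv_eq {τ : K ≃ₐ[L] K} (hτ : Subgroup.zpowers τ = ⊤) {x : K} (hx : τ x = x) :
    x ∈ L := by
  obtain ⟨a, b, c, h⟩ := exists_coords x
  have h1 : τ x = a + b * τ theta + c * τ theta ^ 2 := by
    rw [h]; simp only [map_add, map_mul, map_pow, algEquiv_coe]
  have h2 : τ (τ x) = a + b * τ (τ theta) + c * τ (τ theta) ^ 2 := by
    rw [h1]; simp only [map_add, map_mul, map_pow, algEquiv_coe]
  have hf := theta_cubic
  have h3 : x = ((a - b / 3 + 5 / 3 * c : L) : K) := by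
    push_cast
    rw [hx] at h1 h2
    rw [hx] at h2
    rcases generator_cases hτ with ⟨e1, e2⟩ | ⟨e1, e2⟩ <;> rw [e2] at h2 <;> rw [e1] at h1 <;>
      grind
  rw [h3]
  exact SetLike.coe_mem _

/-- The norm form represents zero only trivially. -/
theorem coords_eq_zero {a b c : L} (h : (a : K) + b * theta + c * theta ^ 2 = 0) :
    a = 0 ∧ b = 0 ∧ c = 0 := by
  obtain ⟨τ, hτ⟩ := exists_algEquiv_theta
  have h' := (mul_conjugates_eq_coe_normForm (zpowers_eq_top hτ) a b c rfl).symm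
  rw [h, zero_mul, zero_mul] at h'
  obtain ⟨h1, h2, h3, -⟩ := eq_zero_of_normForm_eq_omegaL (d := 0)
    (Subtype.coe_injective (h'.trans (congrArg Subtype.val
      (show 0 = omegaL * 0 ^ 3 by ring))))
  subst h3
  have h2 : b = 0 := by simpa using h2
  subst h2
  exact ⟨by simpa using h1, rfl, rfl⟩

end Fields

/-! ### Twisted norms in the division algebra -/

/-- `Υ` as a ring homomorphism; it is multiplicative because `τ` commutes with `σ`. -/
def upsilonHom {τ : K ≃ₐ[L] K} (hτ : Subgroup.zpowers τ = ⊤) : CDA →+* CDA where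
  toFun := QuadCyclicAlgebra.upsilon τ
  map_zero' := QuadCyclicAlgebra.ext (map_zero τ) (map_zero τ)
  map_one' := QuadCyclicAlgebra.ext (map_one τ) (map_zero τ)
  map_add' A B := QuadCyclicAlgebra.ext (map_add τ _ _) (map_add τ _ _)
  map_mul' A B := by
    ext1
    · simp [QuadCyclicAlgebra.upsilon, sigma_comm τ hτ]
    · simp [QuadCyclicAlgebra.upsilon, sigma_comm τ hτ]

theorem upsilon_cube {τ : K ≃ₐ[L] K} (hτ : Subgroup.zpowers τ = ⊤) (A : CDA) :
    upsilonHom hτ (upsilonHom hτ (upsilonHom hτ A)) = A :=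
  QuadCyclicAlgebra.ext (generator_cube hτ _) (generator_cube hτ _)

theorem upsilon_omega {τ : K ≃ₐ[L] K} (hτ : Subgroup.zpowers τ = ⊤) :
    upsilonHom hτ omegaA = omegaA :=
  QuadCyclicAlgebra.ext (algEquiv_omega τ) (map_zero τ)

theorem snd_eq_zero_of_commute {A : CDA} (h : Commute A omegaA) : A.snd = 0 := by
  have h1 := congrArg QuadCyclicAlgebra.snd h.eq
  simp only [QuadCyclicAlgebra.mul_snd, omegaA, QuadCyclicAlgebra.ofField, sigma_omega,
    mul_zero, add_zero, zero_mul, zero_add] at h1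
  have h2 : A.snd * (2 * omega + 1) = 0 := by linear_combination h1
  refine (mul_eq_zero.1 h2).resolve_right fun h3 => ?_
  have h4 : (3 : K) = 0 := by linear_combination 4 * omega_sq_add - (2 * omega + 1) * h3
  norm_num at h4

/-- Applying `Y` moves the first factor of `A Y(A) Y²(A)` to the end, and fixes the product. -/
theorem commute_of_twisted_norm_eq {D : Type*} [DivisionRing D] {Y : D →+* D} {w A : D}
    (hY : Y (Y (Y A)) = A) (hw : Y w = w) (hw0 : w ≠ 0) (h : A * Y A * Y (Y A) = w) :
    Commute A w := by
  have hA : A ≠ 0 := by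
    rintro rfl
    exact hw0 (by rw [← h, zero_mul, zero_mul])
  have h' := congrArg Y h
  rw [map_mul, map_mul, hY, hw] at h'
  change A * w = w * A
  nth_rw 1 [← h']
  rw [← h]
  simp only [mul_assoc]

theorem omegaA_ne_zero : omegaA ≠ 0 := fun h =>
  isPrimitiveRoot_omega.ne_zero (by norm_num) (congrArg QuadCyclicAlgebra.fst h)

theorem twisted_norm_ne_omega {τ : K ≃ₐ[L] K} (hτ : Subgroup.zpowers τ = ⊤) (A : CDA) :
    A * upsilonHom hτ A * upsilonHom hτ (upsilonHom hτ A) ≠ omegaA := by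
  intro h
  have hA := snd_eq_zero_of_commute
    (commute_of_twisted_norm_eq (upsilon_cube hτ A) (upsilon_omega hτ) omegaA_ne_zero h)
  refine norm_ne_omega hτ A.fst ?_
  have h1 := congrArg QuadCyclicAlgebra.fst h
  simpa [upsilonHom, QuadCyclicAlgebra.upsilon, hA, omegaA, QuadCyclicAlgebra.ofField] using h1

/-- A nonzero solution makes `w` a twisted norm: this is the system satisfied by a kernel vector of
a codeword matrix. -/
theorem eq_zero_of_cyclic_system {D : Type*} [DivisionRing D] {Y : D →+* D} {w : D}
    (hY : ∀ A, Y (Y (Y A)) = A) (hw : ∀ A, A * Y A * Y (Y A) ≠ w) {A B x y z : D}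
    (hAB : A ≠ 0 ∨ B ≠ 0) (h1 : A * x + Y (Y B) * (z * w) = 0) (h2 : B * x + Y A * y = 0)
    (h3 : Y B * y + Y (Y A) * z = 0) : x = 0 ∧ y = 0 ∧ z = 0 := by
  have hw0 : w ≠ 0 := fun h => hw 0 (by rw [h, zero_mul, zero_mul])
  have hYne : ∀ {a : D}, a ≠ 0 → Y a ≠ 0 := fun h => (map_ne_zero Y).2 h
  by_cases hA : A = 0
  · have hB := hAB.resolve_left (not_not_intro hA)
    subst hA
    simp [hB, hw0] at h1 h2 h3
    exact ⟨h2, h3, h1⟩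
  by_cases hB : B = 0
  · subst hB
    simp [hA] at h1 h2 h3
    exact ⟨h1, h2, h3⟩
  by_cases hx : x = 0
  · subst hx
    simp [hA, hB, hw0] at h1 h2
    exact ⟨rfl, h2, h1⟩
  exfalso
  rw [add_eq_zero_iff_eq_neg] at h1 h2 h3
  -- The cyclic system telescopes along the twisted norm of this element, from `A x` back to `x w`.
  refine hw (-(x⁻¹ * B⁻¹ * Y A * Y x)) ?_
  have hYx := hYne hx
  have hYYx := hYne hYx
  have e1 : (Y B)⁻¹ * (Y (Y A) * z) = -y := by
    rw [← neg_eq_iff_eq_neg.2 h3, mul_neg, inv_mul_cancel_left₀ (hYne hB)]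
  have e2 : (Y (Y B))⁻¹ * (A * x) = -(z * w) := by
    rw [h1, mul_neg, inv_mul_cancel_left₀ (hYne (hYne hB))]
  have e3 : B⁻¹ * (Y A * y) = -x := by
    rw [← neg_eq_iff_eq_neg.2 h2, mul_neg, inv_mul_cancel_left₀ hB]
  simp only [map_neg, map_mul, map_inv₀, hY, neg_mul, mul_neg, mul_assoc]
  rw [mul_inv_cancel_left₀ hYYx, mul_inv_cancel_left₀ hYx, e2]
  simp only [mul_neg]
  rw [← mul_assoc _ z w, ← mul_assoc _ _ w, e1, neg_mul, mul_neg, mul_neg, ← mul_assoc _ y w,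
    ← mul_assoc _ _ w, e3]
  simp only [neg_mul, neg_neg]
  rw [inv_mul_cancel_left₀ hx]

/-- The codeword matrix of the elements `A = A₀` and `B = A₁` of `𝒜`, with entries in `K`. -/
def codeMatrix (τ : K ≃ₐ[L] K) (A B : CDA) : Matrix (Fin 3 × Fin 2) (Fin 3 × Fin 2) K :=
  Matrix.comp (Fin 3) (Fin 3) (Fin 2) (Fin 2) K
    !![A.toMatrix, 0, omega • (B.toMatrix.map τ).map τ;
       B.toMatrix, A.toMatrix.map τ, 0;
       0, B.toMatrix.map τ, (A.toMatrix.map τ).map τ]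

theorem encode_eq (τ : K ≃ₐ[L] K) (s : Fin 2 × Fin 6 → K) :
    encode τ s =
      (codeMatrix τ (symbolElement s 0) (symbolElement s 1)).map (fun x : K => (x : ℂ)) :=
  rfl

theorem det_encode (τ : K ≃ₐ[L] K) (s : Fin 2 × Fin 6 → K) :
    (encode τ s).det = (codeMatrix τ (symbolElement s 0) (symbolElement s 1)).det := by
  rw [encode_eq]
  exact (RingHom.map_det (algebraMap K ℂ) _).symm

theorem comp_mulVec {R I J : Type*} [CommRing R] [Fintype I] [Fintype J]
    (M : Matrix I I (Matrix J J R)) (v : I × J → R) (i : I) (k : J) :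
    (Matrix.comp I I J J R M *ᵥ v) (i, k) = ∑ j, (M i j *ᵥ fun l => v (j, l)) k := by
  simp [Matrix.mulVec, dotProduct, Fintype.sum_prod_type]

/-- The element `a + j b` of `𝒜`, for the column with entries `a` and `b`: the coordinates with
respect to the basis `1, j` of the right `K`-vector space `𝒜`. -/
def ofVec (v : Fin 2 → K) : CDA := ⟨v 0, v 1⟩

theorem ofVec_mulVec (A : CDA) (v : Fin 2 → K) : ofVec (A.toMatrix *ᵥ v) = A * ofVec v := by
  ext1 <;> simp [ofVec, QuadCyclicAlgebra.toMatrix, Matrix.mulVec, dotProduct]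

/-- The scalar `ω` acts on columns as right multiplication by `ω`, which is not central in `𝒜`. -/
theorem ofVec_smul_mulVec (A : CDA) (v : Fin 2 → K) :
    ofVec ((omega • A.toMatrix) *ᵥ v) = A * (ofVec v * omegaA) := by
  rw [Matrix.smul_mulVec, ← mul_assoc, ← ofVec_mulVec]
  ext1 <;> simp [ofVec, omegaA, QuadCyclicAlgebra.ofField, mul_comm]

theorem ofVec_add (v w : Fin 2 → K) : ofVec (v + w) = ofVec v + ofVec w := rfl

theorem ofVec_zero : ofVec 0 = 0 := rfl

theorem eq_zero_of_ofVec {v : Fin 2 → K} (h : ofVec v = 0) : v = 0 := by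
  refine funext (Fin.forall_fin_two.2 ⟨?_, ?_⟩)
  · exact congrArg QuadCyclicAlgebra.fst h
  · exact congrArg QuadCyclicAlgebra.snd h

theorem toMatrix_upsilon {τ : K ≃ₐ[L] K} (hτ : Subgroup.zpowers τ = ⊤) (A : CDA) :
    A.toMatrix.map τ = (upsilonHom hτ A).toMatrix := by
  ext i j
  fin_cases i <;> fin_cases j <;>
    simp [QuadCyclicAlgebra.toMatrix, upsilonHom, QuadCyclicAlgebra.upsilon, sigma_comm τ hτ]

theorem det_codeMatrix_ne_zero {τ : K ≃ₐ[L] K} (hτ : Subgroup.zpowers τ = ⊤) {A B : CDA}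
    (hAB : A ≠ 0 ∨ B ≠ 0) : (codeMatrix τ A B).det ≠ 0 := by
  intro h
  obtain ⟨v, hv, hmul⟩ := Matrix.exists_mulVec_eq_zero_iff.2 h
  simp only [codeMatrix, toMatrix_upsilon hτ] at hmul
  have hrow : ∀ i, ofVec (∑ j, ((!![A.toMatrix, 0,
      omega • (upsilonHom hτ (upsilonHom hτ B)).toMatrix;
      B.toMatrix, (upsilonHom hτ A).toMatrix, 0;
      0, (upsilonHom hτ B).toMatrix, (upsilonHom hτ (upsilonHom hτ A)).toMatrix] :
        Matrix (Fin 3) (Fin 3) (Matrix (Fin 2) (Fin 2) K)) i j *ᵥ fun l => v (j, l))) = 0 := by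
    intro i
    rw [← ofVec_zero]
    congr 1
    funext k
    have := congrFun hmul (i, k)
    rw [comp_mulVec] at this
    rw [Finset.sum_apply]
    exact this
  simp only [Fin.sum_univ_three, ofVec_add] at hrow
  obtain ⟨hx, hy, hz⟩ := eq_zero_of_cyclic_system (upsilon_cube hτ) (twisted_norm_ne_omega hτ)
    (x := ofVec fun l => v (0, l)) (y := ofVec fun l => v (1, l)) (z := ofVec fun l => v (2, l)) hAB
    (by
      have := hrow 0
      simp only [Matrix.of_apply, Matrix.cons_val, Matrix.zero_mulVec, ofVec_zero, add_zero,
        ofVec_mulVec, ofVec_smul_mulVec] at this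
      exact this)
    (by
      have := hrow 1
      simp only [Matrix.of_apply, Matrix.cons_val, Matrix.zero_mulVec, ofVec_zero, add_zero,
        ofVec_mulVec] at this
      exact this)
    (by
      have := hrow 2
      simp only [Matrix.of_apply, Matrix.cons_val, Matrix.zero_mulVec, ofVec_zero, zero_add,
        ofVec_mulVec] at this
      exact this)
  refine hv (funext fun ⟨i, j⟩ => ?_)
  fin_cases i
  · exact congrFun (eq_zero_of_ofVec hx) j
  · exact congrFun (eq_zero_of_ofVec hy) j
  · exact congrFun (eq_zero_of_ofVec hz) j

/-- The block matrix that conjugates a codeword matrix into its image under `τ`. Its corner is the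
inverse `ω²` of the scalar `ω` in the codeword. -/
def cyclicShift : Matrix (Fin 3) (Fin 3) (Matrix (Fin 2) (Fin 2) K) :=
  !![0, 1, 0; 0, 0, 1; omega ^ 2 • 1, 0, 0]

theorem omega_mul_omega_sq : omega * omega ^ 2 = 1 := by
  rw [← pow_succ', isPrimitiveRoot_omega.pow_eq_one]

theorem omega_sq_mul_omega : omega ^ 2 * omega = 1 := by
  rw [← pow_succ, isPrimitiveRoot_omega.pow_eq_one]

theorem det_comp_cyclicShift_ne_zero :
    (Matrix.comp (Fin 3) (Fin 3) (Fin 2) (Fin 2) K cyclicShift).det ≠ 0 := by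
  have h : cyclicShift * !![0, 0, omega • 1; 1, 0, 0; 0, 1, 0] = 1 := by
    refine Matrix.ext fun i j => ?_
    fin_cases i <;> fin_cases j <;>
      simp [cyclicShift, Matrix.mul_apply, Fin.sum_univ_three, smul_smul, omega_mul_omega_sq]
  have h1 := congrArg (Matrix.compRingEquiv (Fin 3) (Fin 2) K) h
  rw [map_mul, map_one] at h1
  exact Matrix.det_ne_zero_of_right_inverse h1

theorem comp_map {R S I J : Type*} (M : Matrix I I (Matrix J J R)) (f : R → S) :
    (Matrix.comp I I J J R M).map f = Matrix.comp I I J J S (M.map fun X => X.map f) := rfl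

theorem map_det_codeMatrix {τ : K ≃ₐ[L] K} (hτ : Subgroup.zpowers τ = ⊤) (A B : CDA) :
    τ (codeMatrix τ A B).det = (codeMatrix τ A B).det := by
  let e := Matrix.compRingEquiv (Fin 3) (Fin 2) K
  have h3 : ∀ M : Matrix (Fin 2) (Fin 2) K, M.map (τ ∘ τ ∘ τ) = M := fun M =>
    Matrix.ext fun i j => generator_cube hτ _
  have hsmul : ∀ M : Matrix (Fin 2) (Fin 2) K, (omega • M).map τ = omega • M.map τ := fun M =>
    Matrix.ext fun i j => (map_mul τ _ _).trans (congrArg (· * _) (algEquiv_omega τ))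
  have hmap : (codeMatrix τ A B).map τ = e
      !![A.toMatrix.map τ, 0, omega • B.toMatrix;
         B.toMatrix.map τ, (A.toMatrix.map τ).map τ, 0;
         0, (B.toMatrix.map τ).map τ, A.toMatrix] := by
    rw [codeMatrix, comp_map]
    refine congrArg e (Matrix.ext fun i j => ?_)
    fin_cases i <;> fin_cases j <;> simp [h3, hsmul, Matrix.map_zero]
  have hcomm : (codeMatrix τ A B).map τ * e cyclicShift = e cyclicShift * codeMatrix τ A B := by
    rw [hmap]
    change _ = _ * e _
    rw [← map_mul, ← map_mul]
    refine congrArg e (Matrix.ext fun i j => ?_)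
    fin_cases i <;> fin_cases j <;>
      simp [cyclicShift, Matrix.mul_apply, Fin.sum_univ_three, smul_smul, omega_mul_omega_sq,
        omega_sq_mul_omega]
  have hdet := congrArg Matrix.det hcomm
  rw [Matrix.det_mul, Matrix.det_mul, mul_comm] at hdet
  have hE : (e cyclicShift).det ≠ 0 := det_comp_cyclicShift_ne_zero
  calc τ (codeMatrix τ A B).det = ((codeMatrix τ A B).map τ).det :=
        RingHom.map_det (τ : K →+* K) (codeMatrix τ A B)
    _ = (codeMatrix τ A B).det := mul_left_cancel₀ hE hdet

/-! ### The symbols -/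

theorem eq_zero_of_sum_basis {u : Fin 3 → K} (hu : ∀ i, u i ∈ L) (h : ∑ i, u i * basis i = 0) :
    ∀ i, u i = 0 := by
  obtain ⟨v, rfl⟩ : ∃ v : Fin 3 → L, u = fun i => (v i : K) := ⟨fun i => ⟨u i, hu i⟩, rfl⟩
  have hω : omegaL ^ 2 + omegaL + 1 = 0 := Subtype.coe_injective omega_sq_add
  have hcoe : ((omegaL : L) : K) = omega := rfl
  have h2 : ((2 : L) : K) = 2 := map_ofNat (algebraMap L K) 2
  simp only [Fin.sum_univ_three, basis, Matrix.cons_val] at h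
  obtain ⟨e0, e1, e2⟩ := coords_eq_zero
    (a := v 0 * (1 + omegaL) + v 1 * (-1 - 2 * omegaL) + v 2 * (-1 - 2 * omegaL))
    (b := v 0 + v 2 * (1 + omegaL)) (c := v 1 * omegaL + v 2 * (1 + omegaL))
    (by push_cast; rw [h2, hcoe]; linear_combination h)
  have h7 : (7 : L) ≠ 0 := by norm_num
  have hv2 : v 2 = 0 := by
    -- Eliminating `v 0` and `v 1` leaves `(1 - 2ω) v 2 = 0`, and `1 - 2ω` has norm `7`.
    refine (mul_eq_zero.1 (?_ : 7 * v 2 = 0)).resolve_left h7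
    grind
  have hv0 : v 0 = 0 := by simpa [hv2] using e1
  have hω0 : omegaL ≠ 0 := by
    intro h
    simp [h] at hω
  have hv1 : v 1 = 0 := by simpa [hv2, hω0] using e2
  intro i
  fin_cases i
  · simp [hv0]
  · simp [hv1]
  · simp [hv2]

theorem symbolElement_ne_zero {s : Fin 2 × Fin 6 → K} (hs : ∀ i, s i ∈ L) (h0 : s ≠ 0) :
    symbolElement s 0 ≠ 0 ∨ symbolElement s 1 ≠ 0 := by
  by_contra! h
  have key : ∀ k, symbolElement s k = 0 → ∀ i : Fin 6, s (k, i) = 0 := by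
    intro k hk i
    have h1 := eq_zero_of_sum_basis (u := fun i => s (k, Fin.castAdd 3 i)) (fun i => hs _)
      (congrArg QuadCyclicAlgebra.fst hk)
    have h2 := eq_zero_of_sum_basis (u := fun i => s (k, Fin.natAdd 3 i)) (fun i => hs _)
      (congrArg QuadCyclicAlgebra.snd hk)
    exact Fin.addCases (m := 3) (n := 3) (motive := fun i => s (k, i) = 0) h1 h2 i
  refine h0 (funext fun ⟨k, i⟩ => ?_)
  fin_cases k
  · exact key 0 h.1 i
  · exact key 1 h.2 i

theorem det_encode_ne_zero {τ : K ≃ₐ[L] K} (hτ : Subgroup.zpowers τ = ⊤) {s : Fin 2 × Fin 6 → K}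
    (hs : ∀ i, s i ∈ L) (h0 : s ≠ 0) : (encode τ s).det ≠ 0 := by
  rw [det_encode]
  have := det_codeMatrix_ne_zero hτ (symbolElement_ne_zero hs h0)
  exact fun h => this (Subtype.coe_injective h)

/-- Subtraction is written as addition of the negative, in terms of the operations for which the
components in `𝒜` are known. -/
theorem symbolElement_sub (s s' : Fin 2 × Fin 6 → K) (k : Fin 2) :
    symbolElement (s - s') k = symbolElement s k + -symbolElement s' k := by
  ext1 <;>
    simp [symbolElement, add_mul, Finset.sum_add_distrib, sub_eq_add_neg]

theorem toMatrix_add_neg (A B : CDA) : (A + -B).toMatrix = A.toMatrix - B.toMatrix := by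
  refine Matrix.ext fun i j => ?_
  fin_cases i <;> fin_cases j <;> simp [QuadCyclicAlgebra.toMatrix] <;> ring

theorem codeMatrix_add_neg (τ : K ≃ₐ[L] K) (A B A' B' : CDA) :
    codeMatrix τ (A + -A') (B + -B') = codeMatrix τ A B - codeMatrix τ A' B' := by
  have hsub : ∀ M N : Matrix (Fin 2) (Fin 2) K, (M - N).map τ = M.map τ - N.map τ :=
    fun M N => Matrix.ext fun i j => map_sub τ _ _
  unfold codeMatrix
  refine congrArg (Matrix.compRingEquiv (Fin 3) (Fin 2) K) (Eq.trans ?_ rfl) |>.trans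
    (map_sub (Matrix.compRingEquiv (Fin 3) (Fin 2) K) _ _)
  refine Matrix.ext fun i j => ?_
  fin_cases i <;> fin_cases j <;> simp [toMatrix_add_neg, hsub, smul_sub, - Matrix.map_map]

theorem encode_sub (τ : K ≃ₐ[L] K) (s s' : Fin 2 × Fin 6 → K) :
    encode τ (s - s') = encode τ s - encode τ s' := by
  rw [encode_eq, encode_eq, encode_eq, symbolElement_sub, symbolElement_sub, codeMatrix_add_neg]
  rfl

theorem omega_mem : omega ∈ L := IntermediateField.mem_adjoin_simple_self ℚ omega

theorem eisenstein_subset {x : K} (hx : x ∈ eisenstein) : x ∈ L := by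
  obtain ⟨a, b, rfl⟩ := hx
  exact add_mem (intCast_mem L a) (mul_mem omega_mem (intCast_mem L b))

theorem hex_subset {M : ℕ} {x : K} (hx : x ∈ hex M) : x ∈ eisenstein := by
  obtain ⟨a, -, b, -, rfl⟩ := hx
  exact ⟨a, b, rfl⟩

theorem hasFullDiversity_encode {τ : K ≃ₐ[L] K} (hτ : Subgroup.zpowers τ = ⊤) (M : ℕ) :
    HasFullDiversity (encode τ) (hex M) := by
  intro s s' hs hs' hne
  rw [← encode_sub]
  exact det_encode_ne_zero hτ
    (fun i => sub_mem (eisenstein_subset (hex_subset (hs i)))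
      (eisenstein_subset (hex_subset (hs' i))))
    (sub_ne_zero.2 hne)

theorem isIntegral_int_omega : IsIntegral ℤ omega := isPrimitiveRoot_omega.isIntegral (by norm_num)

theorem isIntegral_int_theta : IsIntegral ℤ theta := by
  refine ⟨Polynomial.X ^ 3 + Polynomial.X ^ 2 - 2 * Polynomial.X - 1, by monicity!, ?_⟩
  rw [← theta_cubic]
  simp [Polynomial.eval₂_mul, Polynomial.eval₂_ofNat]

theorem isIntegral_int_basis (i : Fin 3) : IsIntegral ℤ (basis i) := by
  have hω := isIntegral_int_omega
  have hθ := isIntegral_int_theta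
  have h1 : IsIntegral ℤ (1 : K) := isIntegral_one
  have h2 : IsIntegral ℤ (2 : K) := by exact_mod_cast isIntegral_algebraMap (x := (2 : ℤ)) (A := K)
  fin_cases i
  · exact (h1.add hω).add hθ
  · exact (h1.neg.sub (h2.mul hω)).add (hω.mul (hθ.pow 2))
  · exact ((h1.neg.sub (h2.mul hω)).add ((h1.add hω).mul hθ)).add ((h1.add hω).mul (hθ.pow 2))

theorem isIntegral_of_mem_eisenstein {x : K} (hx : x ∈ eisenstein) : IsIntegral ℤ x := by
  obtain ⟨a, b, rfl⟩ := hx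
  exact isIntegral_algebraMap (x := a).add
    (isIntegral_int_omega.mul (isIntegral_algebraMap (x := b)))

theorem isIntegral_toMatrix {A : CDA} (h1 : IsIntegral ℤ A.fst) (h2 : IsIntegral ℤ A.snd)
    (i j : Fin 2) : IsIntegral ℤ (A.toMatrix i j) := by
  have hσ : ∀ {x : K}, IsIntegral ℤ x → IsIntegral ℤ (sigma x) := fun h =>
    map_isIntegral_int (sigma : K →+* K) h
  fin_cases i <;> fin_cases j
  · exact h1
  · simpa [QuadCyclicAlgebra.toMatrix] using hσ h2
  · exact h2
  · exact hσ h1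

theorem isIntegral_det_codeMatrix (τ : K ≃ₐ[L] K) {A B : CDA} (hA1 : IsIntegral ℤ A.fst)
    (hA2 : IsIntegral ℤ A.snd) (hB1 : IsIntegral ℤ B.fst) (hB2 : IsIntegral ℤ B.snd) :
    IsIntegral ℤ (codeMatrix τ A B).det := by
  have hτ : ∀ {x : K}, IsIntegral ℤ x → IsIntegral ℤ (τ x) := fun h =>
    map_isIntegral_int (τ : K →+* K) h
  have hA := isIntegral_toMatrix hA1 hA2
  have hB := isIntegral_toMatrix hB1 hB2
  have h0 : IsIntegral ℤ (0 : K) := isIntegral_zero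
  refine IsIntegral.det fun ⟨i, k⟩ ⟨j, l⟩ => ?_
  fin_cases i <;> fin_cases j
  · exact hA k l
  · exact h0
  · exact isIntegral_int_omega.mul (hτ (hτ (hB k l)))
  · exact hB k l
  · exact hτ (hA k l)
  · exact h0
  · exact h0
  · exact hτ (hB k l)
  · exact hτ (hτ (hA k l))

theorem exists_rat_coords {x : K} (hx : x ∈ L) : ∃ p q : ℚ, x = (p : K) + (q : K) * omega := by
  have hint : IsIntegral ℚ omega := isIntegral_int_omega.tower_top
  have hx' : x ∈ Algebra.adjoin ℚ {omega} := by
    rw [← IntermediateField.adjoin_simple_toSubalgebra_of_isAlgebraic hint.isAlgebraic]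
    exact hx
  clear hx
  induction hx' using Algebra.adjoin_induction with
  | mem x hx => exact ⟨0, 1, by rw [hx]; simp⟩
  | algebraMap r => exact ⟨r, 0, by simp⟩
  | add x y _ _ h1 h2 =>
    obtain ⟨p, q, rfl⟩ := h1
    obtain ⟨p', q', rfl⟩ := h2
    exact ⟨p + p', q + q', by push_cast; ring⟩
  | mul x y _ _ h1 h2 =>
    obtain ⟨p, q, rfl⟩ := h1
    obtain ⟨p', q', rfl⟩ := h2
    refine ⟨p * p' - q * q', p * q' + q * p' - q * q', ?_⟩
    push_cast
    linear_combination (q : K) * q' * omega_sq_add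

/-- `|x|²` is rational for `x` in the imaginary quadratic field `L`, and an algebraic integer. -/
theorem one_le_norm_sq {x : K} (hx : x ∈ L) (hint : IsIntegral ℤ x) (h0 : x ≠ 0) :
    1 ≤ ‖(x : ℂ)‖ ^ 2 := by
  obtain ⟨p, q, hpq⟩ := exists_rat_coords hx
  have h1 : x * sigma x = ((p ^ 2 - p * q + q ^ 2 : ℚ) : K) := by
    rw [hpq]
    simp only [map_add, map_mul, map_ratCast, sigma_omega]
    push_cast
    linear_combination -(q : K) ^ 2 * omega_sq_add
  have h2 : ((‖(x : ℂ)‖ ^ 2 : ℝ) : ℂ) = algebraMap ℚ ℂ (p ^ 2 - p * q + q ^ 2) := by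
    have h3 : (x : ℂ) * (starRingEnd ℂ) (x : ℂ) = ((p ^ 2 - p * q + q ^ 2 : ℚ) : ℂ) :=
      congrArg (algebraMap K ℂ) h1 |>.trans (map_ratCast (algebraMap K ℂ) _)
    rw [Complex.mul_conj, Complex.normSq_eq_norm_sq] at h3
    exact h3
  have h4 : IsIntegral ℤ (algebraMap ℚ ℂ (p ^ 2 - p * q + q ^ 2)) := by
    have := map_isIntegral_int (algebraMap K ℂ)
      (hint.mul (map_isIntegral_int (sigma : K →+* K) hint))
    have h5 : algebraMap K ℂ (x * sigma x) = algebraMap ℚ ℂ (p ^ 2 - p * q + q ^ 2) :=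
      (congrArg (algebraMap K ℂ) h1).trans (map_ratCast (algebraMap K ℂ) _)
    rw [← h5]
    exact this
  rw [isIntegral_algebraMap_iff (algebraMap ℚ ℂ).injective, IsIntegrallyClosed.isIntegral_iff] at h4
  obtain ⟨n, hn⟩ := h4
  rw [← hn] at h2
  have h6 : ‖(x : ℂ)‖ ^ 2 = n := by
    apply Complex.ofReal_injective
    rw [h2]
    simp
  have h7 : 0 < ‖(x : ℂ)‖ ^ 2 := by
    have : (x : ℂ) ≠ 0 := fun h => h0 (Subtype.coe_injective h)
    positivity
  rw [h6] at h7 ⊢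
  exact_mod_cast h7

theorem one_le_norm_sq_det_encode {τ : K ≃ₐ[L] K} (hτ : Subgroup.zpowers τ = ⊤)
    {s : Fin 2 × Fin 6 → K} (hs : ∀ i, s i ∈ eisenstein) (h0 : s ≠ 0) :
    1 ≤ ‖(encode τ s).det‖ ^ 2 := by
  have hne := det_encode_ne_zero hτ (fun i => eisenstein_subset (hs i)) h0
  rw [det_encode] at hne ⊢
  have hterm : ∀ j i, IsIntegral ℤ (s j * basis i) := fun j i =>
    (isIntegral_of_mem_eisenstein (hs j)).mul (isIntegral_int_basis i)
  have hfst : ∀ k, IsIntegral ℤ (symbolElement s k).fst := fun k => by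
    change IsIntegral ℤ (∑ i : Fin 3, s (k, Fin.castAdd 3 i) * basis i)
    exact IsIntegral.sum _ fun i _ => hterm _ i
  have hsnd : ∀ k, IsIntegral ℤ (symbolElement s k).snd := fun k => by
    change IsIntegral ℤ (∑ i : Fin 3, s (k, Fin.natAdd 3 i) * basis i)
    exact IsIntegral.sum _ fun i _ => hterm _ i
  refine one_le_norm_sq (mem_of_algEquiv_eq hτ (map_det_codeMatrix hτ _ _))
    (isIntegral_det_codeMatrix τ (hfst 0) (hsnd 0) (hfst 1) (hsnd 1)) ?_
  exact fun h => hne (by rw [h]; rfl)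

theorem encode_zero (τ : K ≃ₐ[L] K) : encode τ 0 = 0 := by
  have := encode_sub τ 0 0
  rwa [sub_self, sub_self] at this

theorem hasNVD_encode {τ : K ≃ₐ[L] K} (hτ : Subgroup.zpowers τ = ⊤) :
    HasNVD (encode τ) eisenstein := by
  refine lt_of_lt_of_le one_pos (le_csInf ?_ ?_)
  -- The set must be nonempty: the infimum of the empty set is the junk value `0`.
  · have hs : ∀ i : Fin 2 × Fin 6, (1 : Fin 2 × Fin 6 → K) i ∈ eisenstein :=
      fun i => ⟨1, 0, by simp⟩
    refine ⟨_, encode τ 1, ⟨1, hs, rfl⟩, fun h => ?_, rfl⟩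
    have := one_le_norm_sq_det_encode hτ hs one_ne_zero
    rw [h] at this
    norm_num [Matrix.det_zero] at this
  · rintro _ ⟨_, ⟨s, hs, rfl⟩, hne, rfl⟩
    refine one_le_norm_sq_det_encode hτ hs fun h => hne ?_
    rw [h, encode_zero]

end Code62

end

theorem mainTheorem6 :
    (∃ τ : Code62.K ≃ₐ[Code62.L] Code62.K, Subgroup.zpowers τ = ⊤ ∧
      ((τ Code62.theta : Code62.K) : ℂ) = ((2 * Real.cos (4 * Real.pi / 7) : ℝ) : ℂ)) ∧
    ∀ τ : Code62.K ≃ₐ[Code62.L] Code62.K, Subgroup.zpowers τ = ⊤ →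
      (∀ A : Code62.CDA,
        A * QuadCyclicAlgebra.upsilon τ A
          * QuadCyclicAlgebra.upsilon τ (QuadCyclicAlgebra.upsilon τ A) ≠ Code62.omegaA) ∧
      (∀ a : ℕ, 0 < a → Even a → HasFullDiversity (Code62.encode τ) (Code62.hex (2 ^ a))) ∧
      HasNVD (Code62.encode τ) Code62.eisenstein := by
  refine ⟨?_, fun τ hτ => ⟨Code62.twisted_norm_ne_omega hτ,
    fun a _ _ => Code62.hasFullDiversity_encode hτ _, Code62.hasNVD_encode hτ⟩⟩
  obtain ⟨τ, hτ⟩ := Code62.exists_algEquiv_theta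
  exact ⟨τ, Code62.zpowers_eq_top hτ, by rw [hτ, Code62.theta_sq_sub_two_eq]⟩
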